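/- Let $\mathbb F$ be a field, let $n\ge 0$, and let $G$ be a completely reducible subgroup of $\mathrm{GL}(n,\mathbb F)$ (every $G$-invariant subspace of $\mathbb F^n$ has a $G$-invariant complement). Let $l\ge 0$ and let $$1=A_0\lhd A_1\lhd\cdots\lhd A_l\unlhd C_l\lhd\cdots\lhd C_1\lhd C_0=G$$ be a series of subgroups of $G$, with strict inclusions except possibly $A_l\le C_l$, in which each $A_i$ is abelian, each $C_i$ is normal in $G$, and for $1\le i\le l$ the group $C_i$ is the centralizer of $A_i$ in $C_{i-1}$ and $C_{i-1}/C_i$ is abelian. Then the center $\mathsf Z(G)$ is contained in every $C_i$. Moreover, if $G$ is nilpotent, then $G/C_l$ is finite, and $G$ is finite if and only if $C_l$ is finite. -/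

import Mathlib

open scoped MatrixGroups

/-- The natural representation of a matrix group `G ≤ GL(n, F)` on the column space `F ^ n`:
`g` acts by `v ↦ g v`. -/
noncomputable def naturalRep {F : Type*} [Field F] {n : ℕ} (G : Subgroup (GL (Fin n) F)) :
    Representation F G (Fin n → F) where
  toFun g := Matrix.mulVecLin ((g : GL (Fin n) F) : Matrix (Fin n) (Fin n) F)
  map_one' := by simp; rfl
  map_mul' g h := by simp [Matrix.mulVecLin_mul]; rfl

/-- A matrix group `G ≤ GL(n, F)` is completely reducible if every `G`-invariant subspace of
`F ^ n` has a `G`-invariant complement. -/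
def IsCompletelyReducible {F : Type*} [Field F] {n : ℕ} (G : Subgroup (GL (Fin n) F)) : Prop :=
  (naturalRep G).IsSemisimpleRepresentation

/-- A series
`1 = A 0 ⊲ A 1 ⊲ ⋯ ⊲ A l ⊴ C l ⊲ ⋯ ⊲ C 1 ⊲ C 0 = G`
of subgroups of `G`, with strict inclusions except possibly `A l ≤ C l`, in which every `A i` is
abelian, every `C i` is normal in `G`, `C (i + 1)` is the centralizer of `A (i + 1)` in `C i`, and
the factors `C i / C (i + 1)` are abelian.
(`A i` is normal in `A (i + 1)` because the latter is abelian, and `A l` is normal in `C l` because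
`C l` centralizes it.) -/
structure AbelianCentralizerSeries (G : Type*) [Group G] (l : ℕ) where
  A : Fin (l + 1) → Subgroup G
  C : Fin (l + 1) → Subgroup G
  A_zero : A 0 = ⊥
  C_zero : C 0 = ⊤
  A_strictMono : StrictMono A
  C_strictAnti : StrictAnti C
  A_last_le : A (Fin.last l) ≤ C (Fin.last l)
  A_abelian : ∀ i, IsMulCommutative (A i)
  C_normal : ∀ i, (C i).Normal
  C_succ : ∀ i : Fin l,
    C i.succ = C i.castSucc ⊓ Subgroup.centralizer (A i.succ : Set G)
  factor_abelian : ∀ i : Fin l,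
    IsMulCommutative (C i.castSucc ⧸ (C i.succ).subgroupOf (C i.castSucc))

/-! ### Nilpotent groups and their abelian normal subgroups -/

section GroupTheory

open scoped commutatorElement

variable {G : Type*} [Group G]

/-! Central elements centralize every `A i`, so the center lies in every `C i`; it remains to show
that a nilpotent completely reducible `G` is center-by-finite. A maximal abelian normal subgroup `A`
of `G` is self-centralizing. Its enveloping algebra `E` is commutative and, by complete
reducibility, reduced, hence a finite product of fields, where a nonzero polynomial has finitely
many roots. This is used twice: conjugation induces finitely many maps on `E`, so `A` has finite
index; and `A` has finite `m`-torsion for each `m > 0`. Since some power `a ^ M` is always central,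
commutators of `A` with `G` are `M`-torsion, so finite in number, and `A` is finite modulo the
center. -/

theorem Subgroup.isMulCommutative_sup_zpowers {A : Subgroup G} [IsMulCommutative A] {x : G}
    (hx : x ∈ Subgroup.centralizer (A : Set G)) : IsMulCommutative ↥(A ⊔ Subgroup.zpowers x) := by
  have hA : A ≤ Subgroup.centralizer (A : Set G) := Subgroup.le_centralizer A
  have h1 : A ⊔ Subgroup.zpowers x ≤ Subgroup.centralizer (A : Set G) :=
    sup_le hA (by simpa using hx)
  rw [← Subgroup.le_centralizer_iff_isMulCommutative]
  refine sup_le (Subgroup.le_centralizer_iff.mp h1) ?_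
  rw [Subgroup.le_centralizer_iff]
  refine sup_le ?_ ?_
  · rw [Subgroup.le_centralizer_iff]
    simpa using hx
  · exact Subgroup.le_centralizer _

/-- A nilpotent group has a self-centralizing abelian normal subgroup. -/
theorem Group.IsNilpotent.exists_normal_isMulCommutative_centralizer_le
    (hG : Group.IsNilpotent G) :
    ∃ A : Subgroup G, A.Normal ∧ IsMulCommutative A ∧ Subgroup.centralizer (A : Set G) ≤ A := by
  obtain ⟨A, -, hA⟩ := zorn_le_nonempty₀ {A : Subgroup G | A.Normal ∧ IsMulCommutative A}
    (fun c hc hchain B hB ↦ by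
      refine ⟨sSup c, ⟨?_, ?_⟩, fun _ h ↦ le_sSup h⟩
      · refine ⟨fun x hx g ↦ ?_⟩
        rw [Subgroup.mem_sSup_of_directedOn ⟨B, hB⟩ hchain.directedOn] at hx ⊢
        obtain ⟨H, hH, hxH⟩ := hx
        exact ⟨H, hH, (hc hH).1.conj_mem x hxH g⟩
      · rw [← Subgroup.le_centralizer_iff_isMulCommutative]
        intro x hx y hy
        rw [SetLike.mem_coe, Subgroup.mem_sSup_of_directedOn ⟨B, hB⟩ hchain.directedOn] at hy
        rw [Subgroup.mem_sSup_of_directedOn ⟨B, hB⟩ hchain.directedOn] at hx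
        obtain ⟨H, hH, hxH⟩ := hx
        obtain ⟨K, hK, hyK⟩ := hy
        obtain ⟨L, hL, hHL, hKL⟩ := hchain.directedOn H hH K hK
        have := (hc hL).2
        exact setLike_mul_comm (hKL hyK) (hHL hxH))
    ⊥ ⟨inferInstance, inferInstance⟩
  have := hA.prop.1
  have := hA.prop.2
  refine ⟨A, hA.prop.1, hA.prop.2, ?_⟩
  -- For `x` in the next term, all `⁅x, g⁆` lie in `A` by induction, so `A ⊔ ⟨x⟩` is normal and
  -- abelian; maximality gives `x ∈ A`.
  have key : ∀ k, Subgroup.centralizer (A : Set G) ⊓ Subgroup.upperCentralSeries G k ≤ A := by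
    intro k
    induction k with
    | zero => simp
    | succ k ih =>
      rintro x ⟨hx, hxk⟩
      have hcomm : ∀ g : G, g * x * g⁻¹ ∈ A ⊔ Subgroup.zpowers x := by
        intro g
        have hcx : ⁅x, g⁆ ∈ A := by
          refine ih ⟨?_, Subgroup.mem_upperCentralSeries_succ_iff.mp hxk g⟩
          rw [commutatorElement_def, mul_assoc, mul_assoc, ← mul_assoc g]
          exact mul_mem hx (Subgroup.Normal.conj_mem inferInstance _ (inv_mem hx) g)
        have : g * x * g⁻¹ = ⁅x, g⁆⁻¹ * x := by
          rw [commutatorElement_def]; group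
        rw [this]
        exact mul_mem (Subgroup.mem_sup_left (inv_mem hcx))
          (Subgroup.mem_sup_right (Subgroup.mem_zpowers x))
      have hnormal : (A ⊔ Subgroup.zpowers x).Normal := by
        refine ⟨fun y hy g ↦ ?_⟩
        have : A ⊔ Subgroup.zpowers x ≤
            (A ⊔ Subgroup.zpowers x).comap (MulAut.conj g).toMonoidHom := by
          refine sup_le (fun a ha ↦ ?_) ?_
          · exact Subgroup.mem_sup_left (Subgroup.Normal.conj_mem inferInstance a ha g)
          · rw [Subgroup.zpowers_le]
            exact hcomm g
        exact this hy
      exact hA.le_of_ge ⟨hnormal, Subgroup.isMulCommutative_sup_zpowers hx⟩ le_sup_left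
        (Subgroup.mem_sup_right (Subgroup.mem_zpowers x))
  obtain ⟨k, hk⟩ := hG.nilpotent
  simpa [hk] using key k

/-- In a nilpotent group, every element of an abelian normal subgroup of finite index has a power
with bounded exponent in the center. -/
theorem Group.IsNilpotent.exists_pow_mem_center (hG : Group.IsNilpotent G) (A : Subgroup G)
    [A.Normal] [IsMulCommutative A] [A.FiniteIndex] :
    ∃ M : ℕ, 0 < M ∧ ∀ a ∈ A, a ^ M ∈ Subgroup.center G := by
  have hm : 0 < A.index := Nat.pos_of_ne_zero Subgroup.FiniteIndex.index_ne_zero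
  have hcom : ∀ a ∈ A, ∀ g : G, ⁅a, g⁆ ∈ A := fun a ha g ↦ by
    rw [commutatorElement_def, mul_assoc, mul_assoc, ← mul_assoc g]
    exact mul_mem ha (Subgroup.Normal.conj_mem inferInstance _ (inv_mem ha) g)
  have hpow : ∀ a ∈ A, ∀ (g : G) (k : ℕ), ⁅a ^ k, g⁆ = ⁅a, g⁆ ^ k := by
    intro a ha g k
    have hc : Commute a (g * a⁻¹ * g⁻¹) := setLike_mul_comm ha
      (Subgroup.Normal.conj_mem inferInstance _ (inv_mem ha) g)
    have heq : ∀ b : G, ⁅b, g⁆ = b * (g * b⁻¹ * g⁻¹) := fun b ↦ by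
      rw [commutatorElement_def]; group
    rw [heq, heq, hc.mul_pow, conj_pow, inv_pow]
  have key : ∀ k, ∃ M : ℕ, 0 < M ∧ ∀ a ∈ A, a ∈ Subgroup.upperCentralSeries G k →
      a ^ M ∈ Subgroup.center G := by
    intro k
    induction k with
    | zero =>
      refine ⟨1, one_pos, fun a _ h ↦ ?_⟩
      rw [Subgroup.upperCentralSeries_zero, Subgroup.mem_bot] at h
      simp [h, one_mem]
    | succ k ih =>
      obtain ⟨M, hM, h⟩ := ih
      -- With `b = a ^ M` and `z = ⁅b, g⁆` central, conjugation by `g ^ j` multiplies `b` by `z⁻¹ ^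
      -- j`. As `g ^ A.index ∈ A` commutes with `b`, `z ^ A.index = 1`.
      refine ⟨M * A.index, Nat.mul_pos hM hm, fun a ha hak ↦ ?_⟩
      rw [Subgroup.mem_center_iff]
      intro g
      have hz : ⁅a ^ M, g⁆ ∈ Subgroup.center G := by
        rw [hpow a ha]
        exact h _ (hcom a ha g) (Subgroup.mem_upperCentralSeries_succ_iff.mp hak g)
      have haM : a ^ M ∈ A := pow_mem ha M
      rw [pow_mul]
      generalize a ^ M = b at hz haM
      have hconj : ∀ j, g ^ j * b * (g ^ j)⁻¹ = ⁅b, g⁆⁻¹ ^ j * b := by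
        intro j
        induction j with
        | zero => simp
        | succ j ihj =>
          have hz' := Subgroup.mem_center_iff.mp (pow_mem (inv_mem hz) j)
          calc g ^ (j + 1) * b * (g ^ (j + 1))⁻¹ = g * (g ^ j * b * (g ^ j)⁻¹) * g⁻¹ := by
                rw [pow_succ']; group
            _ = ⁅b, g⁆⁻¹ ^ j * (g * b * g⁻¹) := by
                rw [ihj, ← mul_assoc, hz' g]; simp only [mul_assoc]
            _ = ⁅b, g⁆⁻¹ ^ (j + 1) * b := by
                rw [pow_succ, commutatorElement_inv, commutatorElement_def]
                simp only [mul_assoc, inv_mul_cancel, mul_one]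
      have hgA : g ^ A.index ∈ A := Subgroup.pow_index_mem A g
      have h1 := hconj A.index
      rw [setLike_mul_comm hgA haM, mul_inv_cancel_right, eq_comm, mul_eq_right, inv_pow,
        inv_eq_one, ← hpow b haM, commutatorElement_eq_one_iff_mul_comm] at h1
      exact h1.symm
  obtain ⟨k, hk⟩ := hG.nilpotent
  obtain ⟨M, hM, h⟩ := key k
  exact ⟨M, hM, fun a ha ↦ h a ha (by simp [hk])⟩

/-- A nilpotent group with an abelian normal subgroup of finite index with finite `m`-torsion for
all `m > 0` is center-by-finite. -/
theorem Group.IsNilpotent.finiteIndex_center (hG : Group.IsNilpotent G) (A : Subgroup G)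
    [A.Normal] [IsMulCommutative A] [A.FiniteIndex]
    (htors : ∀ m : ℕ, 0 < m → {a : G | a ∈ A ∧ a ^ m = 1}.Finite) :
    (Subgroup.center G).FiniteIndex := by
  obtain ⟨M, hM, h⟩ := hG.exists_pow_mem_center A
  have := (htors M hM).to_subtype
  have hcom : ∀ a : A, ∀ g : G, ⁅(a : G), g⁆ ∈ {a : G | a ∈ A ∧ a ^ M = 1} := by
    rintro ⟨a, ha⟩ g
    have hconj : g * a⁻¹ * g⁻¹ ∈ A := Subgroup.Normal.conj_mem inferInstance _ (inv_mem ha) g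
    have heq : ⁅a, g⁆ = a * (g * a⁻¹ * g⁻¹) := by rw [commutatorElement_def]; group
    have hc : Commute a (g * a⁻¹ * g⁻¹) := setLike_mul_comm ha hconj
    refine ⟨heq ▸ mul_mem ha hconj, ?_⟩
    change ⁅a, g⁆ ^ M = 1
    rw [heq, hc.mul_pow, conj_pow, inv_pow,
      Subgroup.mem_center_iff.mp (inv_mem (h a ha)) g]
    group
  -- Coset representatives suffice to test centrality, since `A` itself is abelian.
  let f : A → (G ⧸ A) → {a : G | a ∈ A ∧ a ^ M = 1} := fun a q ↦ ⟨⁅(a : G), q.out⁆, hcom a q.out⟩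
  have hf : ∀ a b : A, f a = f b → ((a⁻¹ * b : A) : G) ∈ Subgroup.center G := by
    intro a b hab
    have hq : ∀ q : G ⧸ A, Commute ((a⁻¹ * b : A) : G) q.out := by
      intro q
      have h1 : ⁅(a : G), q.out⁆ = ⁅(b : G), q.out⁆ := congrArg Subtype.val (congrFun hab q)
      rw [commutatorElement_def, commutatorElement_def, mul_left_inj] at h1
      have h2 : Commute ((b : G)⁻¹ * a) q.out := by
        have h3 : (b : G)⁻¹ * (a * q.out * (a : G)⁻¹) * a
          = (b : G)⁻¹ * (b * q.out * (b : G)⁻¹) * a := by rw [h1]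
        rw [commute_iff_eq]
        simpa [mul_assoc] using h3
      simpa [mul_inv_rev] using h2.inv_left
    rw [Subgroup.mem_center_iff]
    intro g
    have hg : (g : G ⧸ A).out⁻¹ * g ∈ A := by
      rw [← QuotientGroup.eq]; exact QuotientGroup.out_eq' _
    have := (hq g).mul_right (show Commute ((a⁻¹ * b : A) : G) _ from
      setLike_mul_comm (a⁻¹ * b).2 hg)
    rw [mul_inv_cancel_left] at this
    exact this.eq.symm
  have hfin : Finite (A ⧸ (Subgroup.center G).subgroupOf A) := by
    refine Finite.of_injective
      (fun q : A ⧸ (Subgroup.center G).subgroupOf A ↦ f q.out) fun p q hpq ↦ ?_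
    have := hf _ _ hpq
    rw [← QuotientGroup.out_eq' p, ← QuotientGroup.out_eq' q, QuotientGroup.eq]
    exact this
  have h1 : (Subgroup.center G).relIndex A ≠ 0 :=
    (Subgroup.finiteIndex_iff_finite_quotient.mpr hfin).index_ne_zero
  have h2 : (Subgroup.center G ⊓ A).FiniteIndex := by
    refine ⟨?_⟩
    rw [← Subgroup.relIndex_mul_index inf_le_right, Subgroup.inf_relIndex_right]
    exact mul_ne_zero h1 Subgroup.FiniteIndex.index_ne_zero
  exact Subgroup.finiteIndex_of_le (inf_le_left : Subgroup.center G ⊓ A ≤ _)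

end GroupTheory

/-! ### Reduced Artinian algebras -/

/-- A nonzero polynomial has finitely many roots in a finite-dimensional reduced commutative
algebra over a field. -/
theorem Polynomial.finite_setOf_aeval_eq_zero {F E : Type*} [Field F] [CommRing E] [Algebra F E]
    [Module.Finite F E] [IsReduced E] {p : Polynomial F} (hp : p ≠ 0) :
    {x : E | Polynomial.aeval x p = 0}.Finite := by
  have : IsArtinianRing E := IsArtinianRing.of_finite F E
  let f : E → (∀ m : MaximalSpectrum E, E ⧸ m.asIdeal) := fun x m ↦ Ideal.Quotient.mk _ x
  have hf : Function.Injective f := fun x y hxy ↦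
    (IsArtinianRing.equivPi E).injective (_root_.funext fun m ↦ congrFun hxy m)
  refine Set.Finite.of_finite_image (f := f) ?_ hf.injOn
  refine (Set.Finite.pi' fun m : MaximalSpectrum E ↦
    Polynomial.rootSet_finite p (E ⧸ m.asIdeal)).subset ?_
  rintro _ ⟨x, hx, rfl⟩ m
  rw [Polynomial.mem_rootSet_of_injective (FaithfulSMul.algebraMap_injective F _) hp]
  change Polynomial.aeval (Ideal.Quotient.mkₐ F m.asIdeal x) p = 0
  rw [Polynomial.aeval_algHom_apply, Set.mem_ofPred_eq.mp hx, map_zero]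

/-- If `nilradical E • M` is complemented in a finitely generated faithful module `M` over a
commutative Artinian ring `E`, then `E` is reduced. -/
theorem isReduced_of_isCompl_nilradical_smul_top {E M : Type*} [CommRing E] [IsArtinianRing E]
    [AddCommGroup M] [Module E M] [Module.Finite E M] [FaithfulSMul E M] {W : Submodule E M}
    (hW : IsCompl (nilradical E • (⊤ : Submodule E M)) W) : IsReduced E := by
  -- The nilradical `N` kills `W`, as `N • W ≤ W ⊓ N • M = ⊥`. Hence `N • M = N • (N • M)`, and
  -- Nakayama gives `N • M = ⊥`.
  have hle : nilradical E • (⊤ : Submodule E M) ≤ nilradical E • (nilradical E • ⊤) := by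
    refine Submodule.smul_le.mpr fun x hx v _ ↦ ?_
    have hv : v ∈ nilradical E • (⊤ : Submodule E M) ⊔ W := by
      rw [hW.sup_eq_top]; exact Submodule.mem_top
    obtain ⟨u, hu, w, hw, rfl⟩ := Submodule.mem_sup.mp hv
    have hxw : x • w = 0 := Submodule.disjoint_def.mp hW.disjoint _
      (Submodule.smul_mem_smul hx Submodule.mem_top) (W.smul_mem x hw)
    rw [smul_add, hxw, add_zero]
    exact Submodule.smul_mem_smul hx hu
  have hU : nilradical E • (⊤ : Submodule E M) = ⊥ :=
    Submodule.eq_bot_of_le_smul_of_le_jacobson_bot (nilradical E) _ (IsNoetherian.noetherian _) hle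
      (by rw [IsArtinianRing.jacobson_eq_radical]; exact le_rfl)
  refine ⟨fun x hx ↦ FaithfulSMul.eq_of_smul_eq_smul (α := M) fun v ↦ ?_⟩
  have hxv : x • v ∈ nilradical E • (⊤ : Submodule E M) :=
    Submodule.smul_mem_smul (mem_nilradical.mpr hx) Submodule.mem_top
  rw [hU, Submodule.mem_bot] at hxv
  rw [hxv, zero_smul]

/-! ### Enveloping algebras of abelian normal subgroups -/

namespace Representation

variable {F G V : Type*} [Field F] [Group G] [AddCommGroup V] [Module F V]

/-- Conjugation by `ρ g` as an endomorphism of the endomorphism algebra. -/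
noncomputable def conjAlgHom (ρ : Representation F G V) (g : G) :
    Module.End F V →ₐ[F] Module.End F V :=
  AlgHom.ofLinearMap (LinearMap.mulLeftRight F (ρ g, ρ g⁻¹))
    (by simp [← map_mul])
    (fun x y ↦ by
      have : ρ g⁻¹ * ρ g = 1 := by simp [← map_mul]
      simp only [LinearMap.mulLeftRight_apply]
      calc _ = ρ g * x * 1 * y * ρ g⁻¹ := by simp [mul_assoc]
        _ = _ := by rw [← this]; simp only [mul_assoc])

theorem conjAlgHom_apply (ρ : Representation F G V) (g : G) (x : Module.End F V) :
    ρ.conjAlgHom g x = ρ g * x * ρ g⁻¹ := rfl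

theorem conjAlgHom_apply_rho (ρ : Representation F G V) (g h : G) :
    ρ.conjAlgHom g (ρ h) = ρ (g * h * g⁻¹) := by
  simp [conjAlgHom_apply]

/-- The enveloping algebra of a subgroup in a representation. -/
abbrev envelope (ρ : Representation F G V) (A : Subgroup G) : Subalgebra F (Module.End F V) :=
  Algebra.adjoin F (ρ '' A)

theorem mem_envelope (ρ : Representation F G V) {A : Subgroup G} {a : G} (ha : a ∈ A) :
    ρ a ∈ ρ.envelope A := Algebra.subset_adjoin ⟨a, ha, rfl⟩

theorem conjAlgHom_mem_envelope (ρ : Representation F G V) (A : Subgroup G) [A.Normal] (g : G)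
    {x : Module.End F V} (hx : x ∈ ρ.envelope A) : ρ.conjAlgHom g x ∈ ρ.envelope A := by
  have hle : ρ.envelope A ≤ (ρ.envelope A).comap (ρ.conjAlgHom g) := by
    refine Algebra.adjoin_le ?_
    rintro _ ⟨a, ha, rfl⟩
    change ρ.conjAlgHom g (ρ a) ∈ ρ.envelope A
    rw [conjAlgHom_apply_rho]
    exact ρ.mem_envelope (Subgroup.Normal.conj_mem inferInstance a ha g)
  exact hle hx

open scoped IsMulCommutative

instance isMulCommutative_envelope (ρ : Representation F G V) (A : Subgroup G)
    [IsMulCommutative A] : IsMulCommutative (ρ.envelope A) :=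
  Algebra.isMulCommutative_adjoin F <| by
    rintro _ ⟨a, ha, rfl⟩ _ ⟨b, hb, rfl⟩
    rw [← map_mul, setLike_mul_comm ha hb, map_mul]

theorem apply_mem_of_mem_envelope (ρ : Representation F G V) (A : Subgroup G)
    (W : Subrepresentation ρ) {x : Module.End F V} (hx : x ∈ ρ.envelope A) {w : V}
    (hw : w ∈ W.toSubmodule) : x w ∈ W.toSubmodule := by
  induction hx using Algebra.adjoin_induction generalizing w with
  | mem x hx =>
    obtain ⟨a, -, rfl⟩ := hx
    exact W.apply_mem_toSubmodule a hw
  | algebraMap r => exact W.toSubmodule.smul_mem r hw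
  | add x y _ _ hx hy => exact add_mem (hx hw) (hy hw)
  | mul x y _ _ hx hy => exact hx (hy hw)

/-- The enveloping algebra of an abelian normal subgroup in a semisimple representation is
reduced. -/
theorem isReduced_envelope [Module.Finite F V] (ρ : Representation F G V)
    (hρ : ρ.IsSemisimpleRepresentation) (A : Subgroup G) [A.Normal] [IsMulCommutative A] :
    IsReduced (ρ.envelope A) := by
  have : Module.Finite (ρ.envelope A) V := Module.Finite.of_restrictScalars_finite F _ V
  have : IsArtinianRing (ρ.envelope A) := IsArtinianRing.of_finite F _
  -- `G`-invariant because conjugation by `ρ g` preserves `E` and nilpotency.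
  let U' : Subrepresentation ρ :=
    { toSubmodule := (nilradical (ρ.envelope A) • (⊤ : Submodule (ρ.envelope A) V)).restrictScalars F
      apply_mem_toSubmodule := by
        intro g v hv
        rw [Submodule.restrictScalars_mem] at hv ⊢
        induction hv using Submodule.smul_induction_on' with
        | smul x hx v _ =>
          obtain ⟨k, hk⟩ := mem_nilradical.mp hx
          have hy : (⟨ρ.conjAlgHom g x, ρ.conjAlgHom_mem_envelope A g x.2⟩ : ρ.envelope A) ∈
              nilradical (ρ.envelope A) := by
            refine mem_nilradical.mpr ⟨k, Subtype.ext ?_⟩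
            have hk' : (x : Module.End F V) ^ k = 0 := congrArg Subtype.val hk
            change (ρ.conjAlgHom g (x : Module.End F V)) ^ k = 0
            rw [← map_pow, hk', map_zero]
          have hgx : ρ g (x • v) = (⟨ρ.conjAlgHom g x,
              ρ.conjAlgHom_mem_envelope A g x.2⟩ : ρ.envelope A) • ρ g v := by
            change ρ g ((x : Module.End F V) v) = (ρ g * (x : Module.End F V) * ρ g⁻¹) (ρ g v)
            simp
          rw [hgx]
          exact Submodule.smul_mem_smul hy Submodule.mem_top
        | add v _ w _ hv hw => rw [map_add]; exact add_mem hv hw }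
  obtain ⟨W, hW⟩ := hρ.exists_isCompl U'
  let W' : Submodule (ρ.envelope A) V :=
    { W.toSubmodule with
      smul_mem' := fun x _ hw ↦ ρ.apply_mem_of_mem_envelope A W x.2 hw }
  refine isReduced_of_isCompl_nilradical_smul_top (M := V) (W := W') (isCompl_iff.mpr ⟨?_, ?_⟩)
  · rw [Submodule.disjoint_def]
    intro v hv hw
    have hvw : v ∈ (U' ⊓ W).toSubmodule := ⟨hv, hw⟩
    rw [hW.inf_eq_bot] at hvw
    exact hvw
  · rw [codisjoint_iff, Submodule.eq_top_iff']
    intro v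
    have hv : v ∈ (U' ⊔ W).toSubmodule := by rw [hW.sup_eq_top]; exact Submodule.mem_top
    obtain ⟨u, hu, w, hw, rfl⟩ := Submodule.mem_sup.mp hv
    exact Submodule.add_mem_sup hu hw

/-- A self-centralizing abelian normal subgroup of a group with a faithful semisimple
finite-dimensional representation has finite index. -/
theorem finiteIndex_of_centralizer_le [Module.Finite F V] (ρ : Representation F G V)
    (hρ : ρ.IsSemisimpleRepresentation) (hinj : Function.Injective ρ) (A : Subgroup G) [A.Normal]
    [IsMulCommutative A] (hA : Subgroup.centralizer (A : Set G) ≤ A) : A.FiniteIndex := by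
  have := ρ.isReduced_envelope hρ A
  let E := ρ.envelope A
  let b := Module.finBasis F E
  have hint : ∀ i, IsIntegral F (b i) := fun i ↦ Algebra.IsIntegral.isIntegral (b i)
  -- Conjugation sends each basis vector to a root of its minimal polynomial, leaving finitely many
  -- possible images.
  let T : Fin (Module.finrank F E) → Set E := fun i ↦
    {x | Polynomial.aeval x (minpoly F (b i)) = 0}
  have hT : ∀ i, Finite (T i) := fun i ↦
    (Polynomial.finite_setOf_aeval_eq_zero (minpoly.ne_zero (hint i))).to_subtype
  let c : G → E →ₐ[F] E := fun g ↦
    ((ρ.conjAlgHom g).comp E.val).codRestrict E fun x ↦ ρ.conjAlgHom_mem_envelope A g x.2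
  let f : G → ∀ i, T i := fun g i ↦ ⟨c g (b i), by
    change Polynomial.aeval (c g (b i)) (minpoly F (b i)) = 0
    rw [Polynomial.aeval_algHom_apply, minpoly.aeval, map_zero]⟩
  have hf : ∀ g h, f g = f h → g⁻¹ * h ∈ A := by
    intro g h hgh
    have hc : (c g).toLinearMap = (c h).toLinearMap :=
      b.ext fun i ↦ congrArg Subtype.val (congrFun hgh i)
    refine hA (Subgroup.mem_centralizer_iff.mpr fun a ha ↦ ?_)
    have h1 : ρ.conjAlgHom g (ρ a) = ρ.conjAlgHom h (ρ a) :=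
      congrArg Subtype.val (LinearMap.congr_fun hc ⟨ρ a, ρ.mem_envelope ha⟩)
    rw [conjAlgHom_apply_rho, conjAlgHom_apply_rho] at h1
    have h2 : g⁻¹ * (g * a * g⁻¹) * h = g⁻¹ * (h * a * h⁻¹) * h := by rw [hinj h1]
    simpa [mul_assoc] using h2
  rw [Subgroup.finiteIndex_iff_finite_quotient]
  refine Finite.of_injective (fun q : G ⧸ A ↦ f q.out) fun p q hpq ↦ ?_
  rw [← QuotientGroup.out_eq' p, ← QuotientGroup.out_eq' q, QuotientGroup.eq]
  exact hf _ _ hpq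

/-- A nilpotent group with a faithful semisimple finite-dimensional representation is
center-by-finite. -/
theorem finiteIndex_center_of_isNilpotent [Module.Finite F V] (ρ : Representation F G V)
    (hρ : ρ.IsSemisimpleRepresentation) (hinj : Function.Injective ρ)
    (hG : Group.IsNilpotent G) : (Subgroup.center G).FiniteIndex := by
  obtain ⟨A, _, _, hA⟩ := hG.exists_normal_isMulCommutative_centralizer_le
  have := ρ.finiteIndex_of_centralizer_le hρ hinj A hA
  have := ρ.isReduced_envelope hρ A
  refine hG.finiteIndex_center A fun m hm ↦ ?_
  -- The `m`-torsion of `A` embeds in the roots of `X ^ m - 1`, nonzero in every characteristic.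
  have hfin := Polynomial.finite_setOf_aeval_eq_zero (E := ρ.envelope A)
    (Polynomial.X_pow_sub_C_ne_zero hm (1 : F))
  refine Set.Finite.of_finite_image (f := ρ) ((hfin.image Subtype.val).subset ?_) hinj.injOn
  rintro _ ⟨a, ⟨ha, ham⟩, rfl⟩
  refine ⟨⟨ρ a, ρ.mem_envelope ha⟩, ?_, rfl⟩
  have : (⟨ρ a, ρ.mem_envelope ha⟩ : ρ.envelope A) ^ m = 1 :=
    Subtype.ext (by simp [← map_pow, ham])
  simp [this]

end Representation

/-! ### Application to the series -/

theorem naturalRep_injective {F : Type*} [Field F] {n : ℕ} (G : Subgroup (GL (Fin n) F)) :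
    Function.Injective (naturalRep G) := fun _ _ hgh ↦
  Subtype.ext (Units.ext (Matrix.mulVec_injective
    (funext fun v ↦ LinearMap.congr_fun hgh v)))

theorem AbelianCentralizerSeries.center_le {G : Type*} [Group G] {l : ℕ}
    (S : AbelianCentralizerSeries G l) (i : Fin (l + 1)) : Subgroup.center G ≤ S.C i := by
  induction i using Fin.induction with
  | zero => simp [S.C_zero]
  | succ i ih =>
    rw [S.C_succ]
    exact le_inf ih (Subgroup.center_le_centralizer _)

theorem mainTheorem8 {F : Type*} [Field F] {n : ℕ} (G : Subgroup (GL (Fin n) F))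
    (hG : IsCompletelyReducible G) {l : ℕ} (S : AbelianCentralizerSeries G l) :
    (∀ i, Subgroup.center G ≤ S.C i) ∧
      (Group.IsNilpotent G →
        Finite (G ⧸ S.C (Fin.last l)) ∧ (Finite G ↔ Finite (S.C (Fin.last l)))) := by
  refine ⟨S.center_le, fun hnil ↦ ?_⟩
  have := (naturalRep G).finiteIndex_center_of_isNilpotent hG (naturalRep_injective G) hnil
  have : (S.C (Fin.last l)).FiniteIndex := Subgroup.finiteIndex_of_le (S.center_le _)
  exact ⟨inferInstance, fun _ ↦ inferInstance, fun _ ↦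
    Finite.of_subgroup_quotient (S.C (Fin.last l))⟩
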